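/- **Definitions.** A function $f:\mathbb Z\to\mathbb Z$ is an almost homomorphism if $f(p+q)-f(p)-f(q)$ is bounded over all $p,q\in\mathbb Z$. Write $f\sim_\sigma g$ if $f-g$ is bounded, and let $[f]_\sigma$ be the class of $f$. The Eudoxus reals $\mathbb R$ are the quotient group of almost homomorphisms (under pointwise addition) modulo bounded functions; multiplication is induced by composition, $1$ is the class of the identity, and $[f]_\sigma$ is positive if $\sup_{m\in\mathbb N}f(m)=+\infty$. Let $\mathcal L'=\{+,\cdot,\leqslant,0,1\}\cup\{P_R\}$, where there is an $m$-ary symbol $P_R$ for every relation $R\subseteq\mathbb R^m$ and every $m\ge 1$; $\mathbb R$ is an $\mathcal L'$-structure with $P_R$ interpreted as $R$. A hyperreal field is an ordered field ${}^*\mathbb R$ whose ordered-field structure is expanded to an $\mathcal L'$-structure admitting a non-surjective $\mathcal L'$-elementary embedding $\mathbb R\to{}^*\mathbb R$. For a set $I$, let $\mathcal A(\mathbb Z\times I,\mathbb Z)$ be the set of $F:\mathbb Z\times I\to\mathbb Z$ such that $F(\cdot,i)$ is an almost homomorphism for every $i\in I$. For a filter $\mathcal G$ on $I\times I$, let $\mathcal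 A(\mathbb Z\times I,\mathbb Z)|\mathcal G$ be the set of those $F\in\mathcal A(\mathbb Z\times I,\mathbb Z)$ with $\{(i,j): [F(\cdot,i)]_\sigma=[F(\cdot,j)]_\sigma\}\in\mathcal G$. For an ultrafilter $\mathcal U$ on $I$, let $F\sim_{\sigma\tau}F'$ mean $\{i: F(\cdot,i)\sim_\sigma F'(\cdot,i)\}\in\mathcal U$. The quotient $(\mathcal A(\mathbb Z\times I,\mathbb Z)|\mathcal G)/{\sim_{\sigma\tau}}$ is an $\mathcal L'$-structure: $0$ is the class of the zero function, $1$ that of $(x,i)\mapsto x$, addition is pointwise, multiplication is induced by $(F\cdot F')(x,i)=F(F'(x,i),i)$, and $\leqslant$ (respectively $P_R$) holds of classes $[F_1],\dots,[F_m]$ iff $\leqslant$ (respectively $R$) holds of $[F_1(\cdot,i)]_\sigma,\dots,[F_m(\cdot,i)]_\sigma$ for $\mathcal U$-almost all $i$. The limit ultrapower $(\mathbb R^I/\mathcal U)|\mathcal G$ is the substructure of the ultrapower $\mathbb R^I/\mathcal U$ formed by the classes $[f]_\tau$ of those $f:I\to\mathbb R$ with $\{(i,j): f(i)=f(j)\}\in\mathcal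 G$. **Theorem 4.** For every hyperreal field ${}^*\mathbb R$ that is a set there are an infinite set $I$, a non-principal ultrafilter $\mathcal U$ on $I$ and a proper filter $\mathcal G$ on $I\times I$ such that ${}^*\mathbb R$ is isomorphic, as an $\mathcal L'$-structure (in particular as an ordered field), to $(\mathcal A(\mathbb Z\times I,\mathbb Z)|\mathcal G)/{\sim_{\sigma\tau}}$. Moreover, the map $[F]_{\sigma\tau}\mapsto[\,i\mapsto[F(\cdot,i)]_\sigma\,]_\tau$ is a well-defined $\mathcal L'$-isomorphism from $(\mathcal A(\mathbb Z\times I,\mathbb Z)|\mathcal G)/{\sim_{\sigma\tau}}$ onto the limit ultrapower $(\mathbb R^I/\mathcal U)|\mathcal G$ of the Eudoxus reals. -/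

import Mathlib

open FirstOrder

universe u v w w'

namespace Eudoxus

/-! ### Almost homomorphisms and the Eudoxus reals -/

/-- The function `f : ℤ → ℤ` has bounded range. -/
def IsBoundedFun (f : ℤ → ℤ) : Prop := ∃ C : ℤ, ∀ p, |f p| < C

/-- `f : ℤ → ℤ` is an almost homomorphism: `f (p + q) - f p - f q` is bounded. -/
def IsAlmostHom (f : ℤ → ℤ) : Prop := ∃ C : ℤ, ∀ p q, |f (p + q) - f p - f q| < C

theorem IsBoundedFun.add {f g : ℤ → ℤ} (hf : IsBoundedFun f) (hg : IsBoundedFun g) :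
    IsBoundedFun (f + g) := by
  obtain ⟨C, hC⟩ := hf
  obtain ⟨D, hD⟩ := hg
  refine ⟨C + D, fun p => ?_⟩
  have h1 := abs_lt.1 (hC p)
  have h2 := abs_lt.1 (hD p)
  simp only [Pi.add_apply, abs_lt]
  constructor <;> linarith [h1.1, h1.2, h2.1, h2.2]

theorem IsBoundedFun.neg {f : ℤ → ℤ} (hf : IsBoundedFun f) : IsBoundedFun (-f) := by
  obtain ⟨C, hC⟩ := hf
  exact ⟨C, fun p => by simpa using hC p⟩

theorem isBoundedFun_zero : IsBoundedFun 0 := ⟨1, fun p => by simp⟩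

theorem isAlmostHom_zero : IsAlmostHom 0 := ⟨1, fun p q => by simp⟩

theorem isAlmostHom_id : IsAlmostHom id := ⟨1, fun p q => by simp⟩

theorem IsAlmostHom.add {f g : ℤ → ℤ} (hf : IsAlmostHom f) (hg : IsAlmostHom g) :
    IsAlmostHom (f + g) := by
  obtain ⟨C, hC⟩ := hf
  obtain ⟨D, hD⟩ := hg
  refine ⟨C + D, fun p q => ?_⟩
  have h1 := abs_lt.1 (hC p q)
  have h2 := abs_lt.1 (hD p q)
  simp only [Pi.add_apply, abs_lt]
  constructor <;> linarith [h1.1, h1.2, h2.1, h2.2]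

theorem IsAlmostHom.neg {f : ℤ → ℤ} (hf : IsAlmostHom f) : IsAlmostHom (-f) := by
  obtain ⟨C, hC⟩ := hf
  refine ⟨C, fun p q => ?_⟩
  have h1 := abs_lt.1 (hC p q)
  simp only [Pi.neg_apply, abs_lt]
  constructor <;> linarith [h1.1, h1.2]

theorem IsBoundedFun.isAlmostHom {f : ℤ → ℤ} (hf : IsBoundedFun f) : IsAlmostHom f := by
  obtain ⟨C, hC⟩ := hf
  refine ⟨C + C + C, fun p q => ?_⟩
  have h1 := abs_lt.1 (hC p)
  have h2 := abs_lt.1 (hC q)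
  have h3 := abs_lt.1 (hC (p + q))
  rw [abs_lt]
  constructor <;> linarith [h1.1, h1.2, h2.1, h2.2, h3.1, h3.2]

theorem exists_bound_on_interval (f : ℤ → ℤ) (C : ℤ) : ∃ D : ℤ, ∀ d, |d| < C → |f d| < D := by
  obtain ⟨D, hD⟩ := ((Set.finite_Icc (-C) C).image fun d => |f d|).bddAbove
  refine ⟨D + 1, fun d hd => ?_⟩
  have h := abs_lt.1 hd
  have := hD (Set.mem_image_of_mem (fun d => |f d|) (Set.mem_Icc.2 ⟨h.1.le, h.2.le⟩))
  exact Int.lt_add_one_iff.2 this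

/-- An almost homomorphism carries functions with bounded difference to such functions. -/
theorem IsAlmostHom.comp_sub {α : Type*} {f : ℤ → ℤ} (hf : IsAlmostHom f) {a b : α → ℤ}
    (h : ∃ C : ℤ, ∀ x, |a x - b x| < C) : ∃ C : ℤ, ∀ x, |f (a x) - f (b x)| < C := by
  obtain ⟨C, hC⟩ := hf
  obtain ⟨D, hD⟩ := h
  obtain ⟨K, hK⟩ := exists_bound_on_interval f D
  refine ⟨C + K, fun x => ?_⟩
  have h1 := abs_lt.1 (hC (b x) (a x - b x))
  have h2 := abs_lt.1 (hK _ (hD x))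
  rw [add_sub_cancel] at h1
  rw [abs_lt]
  constructor <;> linarith [h1.1, h1.2, h2.1, h2.2]

theorem IsAlmostHom.comp {f g : ℤ → ℤ} (hf : IsAlmostHom f) (hg : IsAlmostHom g) :
    IsAlmostHom (f ∘ g) := by
  obtain ⟨C, hC⟩ := hg
  obtain ⟨D, hD⟩ := hf.comp_sub (a := fun x : ℤ × ℤ => g (x.1 + x.2))
    (b := fun x => g x.1 + g x.2) ⟨C, fun x => by simpa [sub_sub] using hC x.1 x.2⟩
  obtain ⟨E, hE⟩ := hf
  refine ⟨D + E, fun p q => ?_⟩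
  have h1 := abs_lt.1 (hD (p, q))
  have h2 := abs_lt.1 (hE (g p) (g q))
  simp only [Function.comp_apply, abs_lt] at *
  constructor <;> linarith [h1.1, h1.2, h2.1, h2.2]

/-- The relation `f ∼_σ g`: the difference `f - g` has bounded range. -/
def SigmaEquiv (f g : ℤ → ℤ) : Prop := IsBoundedFun (f - g)

theorem SigmaEquiv.comp {f f' g g' : ℤ → ℤ} (hf : IsAlmostHom f) (h : SigmaEquiv f f')
    (h' : SigmaEquiv g g') : SigmaEquiv (f ∘ g) (f' ∘ g') := by
  obtain ⟨C, hC⟩ := hf.comp_sub (a := g) (b := g') h'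
  obtain ⟨D, hD⟩ := h
  refine ⟨C + D, fun p => ?_⟩
  have h1 := abs_lt.1 (hC p)
  have h2 := abs_lt.1 (hD (g' p))
  simp only [Function.comp_apply, Pi.sub_apply, abs_lt] at *
  constructor <;> linarith [h1.1, h1.2, h2.1, h2.2]

/-- The group `S` of almost homomorphisms, under pointwise addition. -/
def almostHoms : AddSubgroup (ℤ → ℤ) where
  carrier := {f | IsAlmostHom f}
  zero_mem' := isAlmostHom_zero
  add_mem' := IsAlmostHom.add
  neg_mem' := IsAlmostHom.neg

/-- The group `B` of functions with bounded range. -/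
def boundedFuns : AddSubgroup (ℤ → ℤ) where
  carrier := {f | IsBoundedFun f}
  zero_mem' := isBoundedFun_zero
  add_mem' := IsBoundedFun.add
  neg_mem' := IsBoundedFun.neg

/-- The Eudoxus reals: the quotient group `S / B`. -/
abbrev Reals : Type := almostHoms ⧸ boundedFuns.addSubgroupOf almostHoms

/-- The class `[f]_σ` of an almost homomorphism. -/
def mk (f : ℤ → ℤ) (hf : IsAlmostHom f) : Reals := QuotientAddGroup.mk ⟨f, hf⟩

theorem mk_eq_mk {f g : ℤ → ℤ} {hf : IsAlmostHom f} {hg : IsAlmostHom g} :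
    mk f hf = mk g hg ↔ SigmaEquiv f g := by
  rw [mk, mk, eq_comm, QuotientAddGroup.eq, AddSubgroup.mem_addSubgroupOf]
  change IsBoundedFun (-g + f) ↔ IsBoundedFun (f - g)
  rw [neg_add_eq_sub]

/-- Multiplication is induced by composition of almost homomorphisms. -/
instance : Mul Reals where
  mul := Quotient.map₂ (fun f g => ⟨f.1 ∘ g.1, IsAlmostHom.comp f.2 g.2⟩) (by
    rintro f f' hf g g' hg
    have hf := mk_eq_mk.1 (Quotient.sound hf : mk f.1 f.2 = mk f'.1 f'.2)
    have hg := mk_eq_mk.1 (Quotient.sound hg : mk g.1 g.2 = mk g'.1 g'.2)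
    exact Quotient.exact (mk_eq_mk.2 (SigmaEquiv.comp f.2 hf hg) :
      mk (f.1 ∘ g.1) (IsAlmostHom.comp f.2 g.2) = mk (f'.1 ∘ g'.1) (IsAlmostHom.comp f'.2 g'.2)))

/-- The unit is the class of the identity. -/
instance : One Reals where
  one := mk id isAlmostHom_id

/-- The set `P` of positive elements: the classes `[f]` with `sup {f m | m ∈ ℕ} = +∞`. -/
def positives : Set Reals :=
  {x | ∃ (f : ℤ → ℤ) (hf : IsAlmostHom f), mk f hf = x ∧ ∀ C : ℤ, ∃ m : ℕ, C < f m}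

/-- The order with positive set `P`. -/
instance : LE Reals where
  le x y := x = y ∨ y - x ∈ positives

theorem mk_add {f g : ℤ → ℤ} (hf : IsAlmostHom f) (hg : IsAlmostHom g) :
    mk f hf + mk g hg = mk (f + g) (hf.add hg) := rfl

theorem mk_mul {f g : ℤ → ℤ} (hf : IsAlmostHom f) (hg : IsAlmostHom g) :
    mk f hf * mk g hg = mk (f ∘ g) (hf.comp hg) := rfl

/-! ### The language of ordered fields with a symbol for every finitary relation on the reals -/

/-- The function symbols `0`, `1`, `+`, `·`. -/
inductive FunSymbol : ℕ → Type
  | zero : FunSymbol 0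
  | one : FunSymbol 0
  | add : FunSymbol 2
  | mul : FunSymbol 2

/-- The relation symbols: `≤` and a symbol `P_R` for every `R ⊆ ℝ ^ m`, `m ≥ 1`. -/
inductive RelSymbol : ℕ → Type
  | le : RelSymbol 2
  | pred {m : ℕ} (hm : 0 < m) (R : Set (Fin m → Reals)) : RelSymbol m

/-- The language `{+, ·, ≤, 0, 1, P_R}`, `R` running over all finitary relations on `ℝ`. -/
def lang : FirstOrder.Language.{0, 0} := ⟨FunSymbol, RelSymbol⟩

/-- An interpretation on `A` of all the symbols `P_R` (data only). -/
class RelInterp (A : Type v) where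
  /-- The interpretation of `P_R`. -/
  rel : ∀ {m : ℕ}, 0 < m → Set (Fin m → Reals) → Set (Fin m → A)

/-- In the reals, `P_R` is interpreted as `R`. -/
instance : RelInterp Reals where
  rel _ R := R

/-- The expansion of `(A; +, ·, ≤, 0, 1)` by the interpretations of the symbols `P_R`. -/
instance expansion (A : Type v) [Zero A] [One A] [Add A] [Mul A] [LE A] [RelInterp A] :
    lang.Structure A where
  funMap
    | FunSymbol.zero, _ => 0
    | FunSymbol.one, _ => 1
    | FunSymbol.add, x => x 0 + x 1
    | FunSymbol.mul, x => x 0 * x 1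
  RelMap
    | RelSymbol.le, x => x 0 ≤ x 1
    | RelSymbol.pred hm R, x => x ∈ RelInterp.rel hm R

/-- The ordered field `K`, with the given interpretation of the symbols `P_R`, is a hyperreal
field: a proper elementary extension of the reals in the language with all the `P_R`. -/
def IsHyperreal (K : Type v) [Field K] [LinearOrder K] [IsStrictOrderedRing K] [RelInterp K] :
    Prop :=
  ∃ e : Reals ↪ₑ[lang] K, ¬ Function.Surjective e

/-! ### Limit ultrapowers -/

/-- `eq(f) = {(i, j) | f i = f j}`. -/
def eqSet {I : Type u} {A : Type v} (f : I → A) : Set (I × I) := {p | f p.1 = f p.2}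

/-- The limit ultrapower `(A ^ I / U) | G`: the substructure of the ultrapower `A ^ I / U` formed
by the classes of those `f : I → A` for which `eq(f)` belongs to the filter `G`. -/
def limitUltrapower (L : FirstOrder.Language.{w, w'}) (A : Type v) [L.Structure A] {I : Type u}
    (U : Ultrafilter I) (G : Filter (I × I)) :
    L.Substructure ((U : Filter I).Product fun _ => A) where
  carrier := {x | ∃ f : I → A, eqSet f ∈ G ∧ (f : (U : Filter I).Product fun _ => A) = x}
  fun_mem := by
    intro n φ x hx
    choose f hf hfx using hx
    refine ⟨fun i => Language.Structure.funMap φ fun k => f k i, ?_, ?_⟩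
    · refine Filter.mem_of_superset (Filter.iInter_mem.2 hf) fun p hp => ?_
      have hp : ∀ k, f k p.1 = f k p.2 := fun k => Set.mem_iInter.1 hp k
      simp only [eqSet, Set.mem_ofPred_eq, hp]
    · rw [← Language.Ultraproduct.funMap_cast]
      exact congrArg _ (funext hfx)

/-! ### The one-step construction from integer-valued functions -/

section OneStep

variable {I : Type u}

/-- `A(ℤ × I, ℤ)`: the functions `F : ℤ × I → ℤ` with every `F(·, i)` an almost homomorphism. -/
def AFun (I : Type u) : Type u :=
  {F : ℤ × I → ℤ // ∀ i, IsAlmostHom fun x => F (x, i)}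

/-- The function `i ↦ [F(·, i)]_σ` from `I` to the reals. -/
def AFun.cls (F : AFun I) (i : I) : Reals := mk (fun x => F.1 (x, i)) (F.2 i)

/-- `A(ℤ × I, ℤ) | G`: those `F` with `eq(F) = {(i, j) | [F(·, i)]_σ = [F(·, j)]_σ}` in `G`. -/
def AFunOn (G : Filter (I × I)) : Type u :=
  {F : AFun I // {p : I × I | F.cls p.1 = F.cls p.2} ∈ G}

/-- The relation `F ∼_στ F'`: `F(·, i) ∼_σ F'(·, i)` for `U`-almost all `i`. -/
def SigmaTauEquiv (U : Ultrafilter I) (F F' : AFun I) : Prop :=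
  {i | SigmaEquiv (fun x => F.1 (x, i)) (fun x => F'.1 (x, i))} ∈ U

theorem sigmaTauEquiv_iff {U : Ultrafilter I} {F F' : AFun I} :
    SigmaTauEquiv U F F' ↔ ∀ᶠ i in (U : Filter I), F.cls i = F'.cls i := by
  simp only [AFun.cls, mk_eq_mk]
  rfl

/-- The relation `∼_στ` on `A(ℤ × I, ℤ) | G`. -/
def sigmaTauSetoid (U : Ultrafilter I) (G : Filter (I × I)) : Setoid (AFunOn G) where
  r F F' := SigmaTauEquiv U F.1 F'.1
  iseqv :=
    { refl := fun _ => sigmaTauEquiv_iff.2 (Filter.Eventually.of_forall fun _ => rfl)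
      symm := fun h => sigmaTauEquiv_iff.2 ((sigmaTauEquiv_iff.1 h).mono fun _ h => h.symm)
      trans := fun h h' => sigmaTauEquiv_iff.2
        ((sigmaTauEquiv_iff.1 h).mp ((sigmaTauEquiv_iff.1 h').mono fun _ h' h => h.trans h')) }

variable {G : Filter (I × I)}

/-- The zero function. -/
instance : Zero (AFunOn G) where
  zero := ⟨⟨fun _ => 0, fun _ => isAlmostHom_zero⟩, Filter.mem_of_superset Filter.univ_mem
    fun _ _ => rfl⟩

/-- The function `(x, i) ↦ x`. -/
instance : One (AFunOn G) where
  one := ⟨⟨fun p => p.1, fun _ => isAlmostHom_id⟩, Filter.mem_of_superset Filter.univ_mem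
    fun _ _ => rfl⟩

/-- Pointwise addition. -/
instance : Add (AFunOn G) where
  add F F' := ⟨⟨fun p => F.1.1 p + F'.1.1 p, fun i => (F.1.2 i).add (F'.1.2 i)⟩, by
    refine Filter.mem_of_superset (Filter.inter_mem F.2 F'.2) fun p hp => ?_
    change F.1.cls p.1 + F'.1.cls p.1 = F.1.cls p.2 + F'.1.cls p.2
    rw [show F.1.cls p.1 = F.1.cls p.2 from hp.1, show F'.1.cls p.1 = F'.1.cls p.2 from hp.2]⟩

/-- Composition in the variable `x`: `(F * F')(x, i) = F(F'(x, i), i)`. -/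
instance : Mul (AFunOn G) where
  mul F F' := ⟨⟨fun p => F.1.1 (F'.1.1 p, p.2), fun i => (F.1.2 i).comp (F'.1.2 i)⟩, by
    refine Filter.mem_of_superset (Filter.inter_mem F.2 F'.2) fun p hp => ?_
    change F.1.cls p.1 * F'.1.cls p.1 = F.1.cls p.2 * F'.1.cls p.2
    rw [show F.1.cls p.1 = F.1.cls p.2 from hp.1, show F'.1.cls p.1 = F'.1.cls p.2 from hp.2]⟩

theorem cls_add (F F' : AFunOn G) (i : I) : (F + F').1.cls i = F.1.cls i + F'.1.cls i := rfl

theorem cls_mul (F F' : AFunOn G) (i : I) : (F * F').1.cls i = F.1.cls i * F'.1.cls i := rfl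

/-- The operations on representatives and the relations (holding for `U`-almost all `i`). -/
instance oneStepPrestructure (U : Ultrafilter I) (G : Filter (I × I)) :
    lang.Prestructure (sigmaTauSetoid U G) where
  toStructure :=
    { funMap := fun
        | FunSymbol.zero, _ => 0
        | FunSymbol.one, _ => 1
        | FunSymbol.add, F => F 0 + F 1
        | FunSymbol.mul, F => F 0 * F 1
      RelMap := fun
        | RelSymbol.le, F => {i | (F 0).1.cls i ≤ (F 1).1.cls i} ∈ U
        | RelSymbol.pred _ R, F => {i | (fun k => (F k).1.cls i) ∈ R} ∈ U }
  fun_equiv := by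
    intro n φ x y h
    have h : ∀ k, ∀ᶠ i in (U : Filter I), (x k).1.cls i = (y k).1.cls i :=
      fun k => sigmaTauEquiv_iff.1 (h k)
    refine sigmaTauEquiv_iff.2 ?_
    cases φ with
    | zero => exact Filter.Eventually.of_forall fun _ => rfl
    | one => exact Filter.Eventually.of_forall fun _ => rfl
    | add =>
      filter_upwards [h 0, h 1] with i h0 h1
      rw [cls_add, cls_add, h0, h1]
    | mul =>
      filter_upwards [h 0, h 1] with i h0 h1
      rw [cls_mul, cls_mul, h0, h1]
  rel_equiv := by
    intro n r x y h
    have h : ∀ᶠ i in (U : Filter I), ∀ k, (x k).1.cls i = (y k).1.cls i :=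
      Filter.eventually_all.2 fun k => sigmaTauEquiv_iff.1 (h k)
    cases r with
    | le =>
      refine propext (Filter.eventually_congr (h.mono fun i hi => ?_))
      simp only [hi]
    | pred hm R =>
      refine propext (Filter.eventually_congr (h.mono fun i hi => ?_))
      simp only [hi]

/-- The quotient `(A(ℤ × I, ℤ) | G) / ∼_στ`. -/
def OneStep (U : Ultrafilter I) (G : Filter (I × I)) : Type u :=
  Quotient (sigmaTauSetoid U G)

instance oneStepStructure (U : Ultrafilter I) (G : Filter (I × I)) :
    lang.Structure (OneStep U G) :=
  @Language.quotientStructure lang (AFunOn G) (sigmaTauSetoid U G) (oneStepPrestructure U G)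

/-- The class `[F]_στ`. -/
def OneStep.mk (U : Ultrafilter I) (F : AFunOn G) : OneStep U G :=
  Quotient.mk (sigmaTauSetoid U G) F

end OneStep

end Eudoxus

/-! Take `I` to be the set of all functions `i : K → Reals`, and send `b : K` to the evaluation `i ↦
i b`. For a finite tuple `x` in `K` satisfying `P_R`, the set `{i | i ∘ x ∈ R}` should be large. By
elementarity these sets form a proper filter (`typeFilter_neBot`). Let `U` be any ultrafilter above
it. Since `K` interprets `P_{Rᶜ}` as the complement of `P_R`, `i ∘ x ∈ R` holds `U`-almost
everywhere exactly when `x` satisfies `P_R` (`eventually_comp_mem_iff`). Equality, `≤` and the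
graphs of the operations are among the relations `R`, so evaluation embeds `K` in the ultrapower.

The filter `G` cuts the ultrapower down to the image. It is generated by the equality sets of
evaluations, so an admissible `f` has the form `i ↦ g (i ∘ x)` with `x` finite. The graph of `g` is
a named relation, total in `K` by transfer, and this gives `c : K` whose evaluation equals `f`
almost everywhere (`exists_eventually_eq_eval`). Thus `K` is the limit ultrapower.

If `U` were concentrated at a point `i`, then `i` would be an injective left inverse of `e`, making
`e` surjective. Finally, the one-step quotient is the same limit ultrapower, seen by choosing almost
homomorphisms fibrewise. -/

namespace Eudoxus

/-! ### The filter of evaluations -/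

section EvalFilter

variable {K : Type u}

/-- The filter on pairs generated by the equality sets of the evaluations. -/
def evalFilter (K : Type u) : Filter ((K → Reals) × (K → Reals)) :=
  ⨅ b : K, Filter.principal (eqSet fun i : K → Reals => i b)

theorem eqSet_eval_mem (b : K) : eqSet (fun i : K → Reals => i b) ∈ evalFilter K :=
  Filter.mem_iInf_of_mem b (Filter.mem_principal_self _)

instance evalFilter_neBot : (evalFilter K).NeBot := by
  -- Every equality set contains the diagonal, so any diagonal point bounds the filter from below.
  have h : (pure (0, 0) : Filter ((K → Reals) × (K → Reals))) ≤ evalFilter K :=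
    le_iInf fun b => by simp [eqSet]
  exact Filter.neBot_of_le h

/-- A function whose equality set lies in `evalFilter K` depends on finitely many coordinates. -/
theorem exists_factorsThrough_of_eqSet_mem {f : (K → Reals) → Reals}
    (hf : eqSet f ∈ evalFilter K) :
    ∃ (n : ℕ) (x : Fin n → K), f.FactorsThrough fun i => i ∘ x := by
  obtain ⟨t, ht, hft⟩ := (Filter.hasBasis_iInf_principal_finite _).mem_iff.1 hf
  obtain ⟨n, x, rfl⟩ := ht.fin_embedding
  refine ⟨n, x, fun i j hij => ?_⟩
  refine hft (a := (i, j)) (Set.mem_iInter₂.2 ?_)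
  rintro _ ⟨k, rfl⟩
  exact congrFun hij k

end EvalFilter

/-- A relation holds in an ultraproduct iff it holds in almost all factors. -/
theorem relMap_ultraproduct_cast {L : FirstOrder.Language.{w, w'}} {I : Type u} {A : I → Type v}
    [∀ i, L.Structure (A i)] {U : Ultrafilter I} {n : ℕ} (r : L.Relations n)
    (x : Fin n → ∀ i, A i) :
    Language.Structure.RelMap r (fun k => (x k : (U : Filter I).Product A)) ↔
      ∀ᶠ i in (U : Filter I), Language.Structure.RelMap r fun k => x k i :=
  Language.relMap_quotient_mk' (s := (U : Filter I).productSetoid A)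
    (ps := Language.Ultraproduct.setoidPrestructure A U) r x

/-! ### Transfer between the reals and an elementary extension -/

section Transfer

variable {K : Type u} [Zero K] [One K] [Add K] [Mul K] [LE K] [RelInterp K]
  {m n : ℕ}

/-- The formula `P_R(x ∘ σ)` in the variables `x`. -/
def predFormula (hm : 0 < m) (R : Set (Fin m → Reals)) (σ : Fin m → Fin n) :
    lang.BoundedFormula Empty n :=
  Language.Relations.boundedFormula (RelSymbol.pred hm R : lang.Relations m)
    fun k => Language.Term.var (Sum.inr (σ k))

theorem realize_predFormula {hm : 0 < m} {R : Set (Fin m → Reals)} {σ : Fin m → Fin n}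
    {v : Empty → K} {x : Fin n → K} :
    (predFormula hm R σ).Realize v x ↔ x ∘ σ ∈ RelInterp.rel hm R :=
  Iff.rfl

theorem realize_predFormula_reals {hm : 0 < m} {R : Set (Fin m → Reals)} {σ : Fin m → Fin n}
    {v : Empty → Reals} {x : Fin n → Reals} :
    (predFormula hm R σ).Realize v x ↔ x ∘ σ ∈ R :=
  Iff.rfl

/-- In an elementary extension, the symbol of a definable relation is interpreted as the relation
defined by the same formula. -/
theorem mem_rel_definable (e : Reals ↪ₑ[lang] K) (hn : 0 < n) (φ : lang.BoundedFormula Empty n)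
    {R : Set (Fin n → Reals)} (hR : ∀ v y, y ∈ R ↔ φ.Realize v y) (x : Fin n → K) :
    x ∈ RelInterp.rel hn R ↔ φ.Realize default x := by
  -- The equivalence of `P_R` with `φ`, universally closed, is a sentence true in the reals, so it
  -- transfers.
  have h : Reals ⊨ ((predFormula hn R id).iff φ).alls := by
    refine Language.BoundedFormula.realize_alls.2 fun y => ?_
    exact Language.BoundedFormula.realize_iff.2 (realize_predFormula_reals.trans (hR _ y))
  have h' := Language.BoundedFormula.realize_alls.1 ((e.map_sentence _).1 h) x
  rw [Unique.eq_default (default : Empty → K)]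
  exact realize_predFormula.symm.trans (Language.BoundedFormula.realize_iff.1 h')

theorem mem_rel_univ (e : Reals ↪ₑ[lang] K) (hn : 0 < n) (x : Fin n → K) :
    x ∈ RelInterp.rel hn (Set.univ : Set (Fin n → Reals)) :=
  (mem_rel_definable e hn ⊤ (fun _ _ => by simp) x).2 (by simp)

theorem mem_rel_compl (e : Reals ↪ₑ[lang] K) (hn : 0 < n) (R : Set (Fin n → Reals))
    (x : Fin n → K) : x ∈ RelInterp.rel hn Rᶜ ↔ x ∉ RelInterp.rel hn R :=
  mem_rel_definable e hn (predFormula hn R id).not (fun _ _ => Iff.rfl) x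

theorem mem_rel_inter (e : Reals ↪ₑ[lang] K) (hn : 0 < n) (R S : Set (Fin n → Reals))
    (x : Fin n → K) :
    x ∈ RelInterp.rel hn (R ∩ S) ↔ x ∈ RelInterp.rel hn R ∧ x ∈ RelInterp.rel hn S :=
  (mem_rel_definable e hn (predFormula hn R id ⊓ predFormula hn S id) (R := R ∩ S)
    (fun _ _ => by rw [Language.BoundedFormula.realize_inf]; rfl) x).trans
    Language.BoundedFormula.realize_inf

theorem mem_rel_preimage (e : Reals ↪ₑ[lang] K) (hm : 0 < m) (hn : 0 < n)
    (R : Set (Fin m → Reals)) (σ : Fin m → Fin n) (x : Fin n → K) :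
    x ∈ RelInterp.rel hn ((fun y => y ∘ σ) ⁻¹' R) ↔ x ∘ σ ∈ RelInterp.rel hm R :=
  mem_rel_definable e hn (predFormula hm R σ) (fun _ _ => Iff.rfl) x

theorem mem_rel_eq (e : Reals ↪ₑ[lang] K) (hn : 0 < n) (k l : Fin n) (x : Fin n → K) :
    x ∈ RelInterp.rel hn {y : Fin n → Reals | y k = y l} ↔ x k = x l :=
  mem_rel_definable e hn ((Language.Term.var (Sum.inr k)).bdEqual (Language.Term.var (Sum.inr l)))
    (fun _ _ => Iff.rfl) x

theorem mem_rel_le (e : Reals ↪ₑ[lang] K) (hn : 0 < n) (k l : Fin n) (x : Fin n → K) :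
    x ∈ RelInterp.rel hn {y : Fin n → Reals | y k ≤ y l} ↔ x k ≤ x l :=
  mem_rel_definable e hn (Language.Relations.boundedFormula (RelSymbol.le : lang.Relations 2)
    fun j => Language.Term.var (Sum.inr (![k, l] j))) (fun _ _ => Iff.rfl) x

/-- Passing to the graph raises the arity to `n + 1`, so the constants are covered although every
`P_R` has positive arity. -/
theorem mem_rel_funMap (e : Reals ↪ₑ[lang] K) (f : lang.Functions n) (x : Fin (n + 1) → K) :
    x ∈ RelInterp.rel n.succ_pos {y : Fin (n + 1) → Reals |
      y (Fin.last n) = Language.Structure.funMap f (y ∘ Fin.castSucc)} ↔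
      x (Fin.last n) = Language.Structure.funMap f (x ∘ Fin.castSucc) :=
  mem_rel_definable e n.succ_pos ((Language.Term.var (Sum.inr (Fin.last n))).bdEqual
    (Language.Term.func f fun j => Language.Term.var (Sum.inr j.castSucc))) (fun _ _ => Iff.rfl) x

theorem nonempty_of_mem_rel (e : Reals ↪ₑ[lang] K) (hn : 0 < n) {R : Set (Fin n → Reals)}
    {x : Fin n → K} (hx : x ∈ RelInterp.rel hn R) : R.Nonempty := by
  by_contra h
  have h' : Rᶜ = Set.univ := by rw [Set.not_nonempty_iff_eq_empty.1 h, Set.compl_empty]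
  exact (mem_rel_compl e hn R x).1 (h' ▸ mem_rel_univ e hn x) hx

/-- The extension of a function on the reals is total. -/
theorem exists_snoc_mem_rel_graph (e : Reals ↪ₑ[lang] K) (g : (Fin n → Reals) → Reals)
    (x : Fin n → K) : ∃ c : K, (Fin.snoc x c : Fin (n + 1) → K) ∈
      RelInterp.rel n.succ_pos
        {y : Fin (n + 1) → Reals | y (Fin.last n) = g (y ∘ Fin.castSucc)} := by
  set R := {y : Fin (n + 1) → Reals | y (Fin.last n) = g (y ∘ Fin.castSucc)}
  have h : Reals ⊨ (predFormula n.succ_pos R id).ex.alls := by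
    refine Language.BoundedFormula.realize_alls.2 fun y => ?_
    refine Language.BoundedFormula.realize_ex.2 ⟨g y, realize_predFormula_reals.2 ?_⟩
    change Fin.snoc (α := fun _ => Reals) y (g y) (Fin.last n) =
      g (Fin.snoc (α := fun _ => Reals) y (g y) ∘ Fin.castSucc)
    rw [Fin.snoc_last]
    congr 1
    funext k
    simp
  have h' := Language.BoundedFormula.realize_alls.1 ((e.map_sentence _).1 h) x
  exact Language.BoundedFormula.realize_ex.1 h'

/-! ### The limit ultrapower of evaluations -/

/-- The filter on `K → ℝ` generated by the sets `{i | i ∘ x ∈ R}`, where `x` satisfies `P_R`. -/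
def typeFilter (e : Reals ↪ₑ[lang] K) : Filter (K → Reals) where
  sets := {A | ∃ (n : ℕ) (hn : 0 < n) (x : Fin n → K) (R : Set (Fin n → Reals)),
    x ∈ RelInterp.rel hn R ∧ {i : K → Reals | i ∘ x ∈ R} ⊆ A}
  univ_sets := ⟨1, one_pos, fun _ => 0, Set.univ, mem_rel_univ e _ _, Set.subset_univ _⟩
  sets_of_superset := by
    rintro A B ⟨n, hn, x, R, hx, hA⟩ hAB
    exact ⟨n, hn, x, R, hx, hA.trans hAB⟩
  inter_sets := by
    rintro A B ⟨n, hn, x, R, hx, hA⟩ ⟨m, hm, y, S, hy, hB⟩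
    have hl : Fin.append x y ∘ Fin.castAdd m = x := funext fun k => Fin.append_left x y k
    have hr : Fin.append x y ∘ Fin.natAdd n = y := funext fun k => Fin.append_right x y k
    -- Concatenating the two tuples turns the intersection into a single condition on `n + m`
    -- coordinates.
    refine ⟨n + m, Nat.add_pos_left hn m, Fin.append x y,
      ((fun z => z ∘ Fin.castAdd m) ⁻¹' R) ∩ ((fun z => z ∘ Fin.natAdd n) ⁻¹' S),
      (mem_rel_inter e _ _ _ _).2 ⟨(mem_rel_preimage e hn _ _ _ _).2 (by rwa [hl]),
        (mem_rel_preimage e hm _ _ _ _).2 (by rwa [hr])⟩, fun i hi => ⟨hA ?_, hB ?_⟩⟩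
    · have := hi.1
      rwa [Set.mem_preimage, Function.comp_assoc, hl] at this
    · have := hi.2
      rwa [Set.mem_preimage, Function.comp_assoc, hr] at this

/-- A point `y` of `R` has the form `i ∘ x` exactly when it respects all coincidences among the
entries of `x`. These are finitely many equalities satisfied by `x`, so they can be added to `R`
before transferring nonemptiness. -/
instance typeFilter_neBot (e : Reals ↪ₑ[lang] K) : (typeFilter e).NeBot := by
  refine Filter.forall_mem_nonempty_iff_neBot.1 ?_
  rintro A ⟨n, hn, x, R, hx, hA⟩
  have key : ∀ s : Finset (Fin n × Fin n),
      x ∈ RelInterp.rel hn (R ∩ {y | ∀ p ∈ s, x p.1 = x p.2 → y p.1 = y p.2}) := by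
    classical
    intro s
    induction s using Finset.induction_on with
    | empty => simpa using hx
    | insert p s _ ih =>
      have hp : x ∈ RelInterp.rel hn {y : Fin n → Reals | x p.1 = x p.2 → y p.1 = y p.2} := by
        -- If the entries differ, the condition is vacuous and its relation is everything.
        by_cases h : x p.1 = x p.2
        · simpa [h] using (mem_rel_eq e hn p.1 p.2 x).2 h
        · simpa [h] using mem_rel_univ e hn x
      convert (mem_rel_inter e hn _ _ x).2 ⟨ih, hp⟩ using 2
      ext y
      simp only [Finset.forall_mem_insert, Set.mem_inter_iff, Set.mem_ofPred_eq]
      tauto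
  obtain ⟨y, hyR, hy⟩ := nonempty_of_mem_rel e hn (key Finset.univ)
  -- Values off the range of `x` play no role; `0` is a filler.
  refine ⟨Function.extend x y 0, hA ?_⟩
  have hf : Function.FactorsThrough y x := fun k l h => hy (k, l) (Finset.mem_univ _) h
  have : Function.extend x y 0 ∘ x = y := funext fun k => hf.extend_apply 0 k
  simpa only [Set.mem_ofPred_eq, this] using hyR

/-- An ultrafilter on `K → ℝ` for which evaluation at elements of `K` reflects the structure. -/
noncomputable def typeUltrafilter (e : Reals ↪ₑ[lang] K) : Ultrafilter (K → Reals) :=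
  Ultrafilter.of (typeFilter e)

theorem eventually_comp_mem_iff (e : Reals ↪ₑ[lang] K) (hn : 0 < n) {R : Set (Fin n → Reals)}
    {x : Fin n → K} : (∀ᶠ i in (typeUltrafilter e : Filter (K → Reals)), i ∘ x ∈ R) ↔
      x ∈ RelInterp.rel hn R := by
  have key : ∀ S : Set (Fin n → Reals), x ∈ RelInterp.rel hn S →
      ∀ᶠ i in (typeUltrafilter e : Filter (K → Reals)), i ∘ x ∈ S := fun S hS =>
    Ultrafilter.of_le (typeFilter e) ⟨n, hn, x, S, hS, subset_rfl⟩
  refine ⟨fun h => ?_, key R⟩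
  by_contra hx
  obtain ⟨i, hi, hi'⟩ := (h.and (key _ ((mem_rel_compl e hn R x).2 hx))).exists
  exact hi' hi

theorem typeUltrafilter_ne_pure (e : Reals ↪ₑ[lang] K) (he : ¬ Function.Surjective e)
    (i : K → Reals) : typeUltrafilter e ≠ pure i := by
  intro hU
  -- At a point mass, "almost everywhere" means "at `i`", so equality of values at `i` reflects to
  -- equality in `K`.
  have key : ∀ {x y : K}, i x = i y → x = y := by
    intro x y h
    refine (mem_rel_eq e two_pos 0 1 ![x, y]).1 ((eventually_comp_mem_iff e two_pos).1 ?_)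
    rw [hU]
    exact h
  -- The singleton `{r}` is a named relation satisfied by `e r`.
  have hi : ∀ r, i (e r) = r := by
    intro r
    have h : (fun _ => e r) ∈ RelInterp.rel one_pos {y : Fin 1 → Reals | y 0 = r} :=
      (e.map_boundedFormula (predFormula one_pos {y : Fin 1 → Reals | y 0 = r} id) default
        fun _ => r).2 rfl
    have h := (eventually_comp_mem_iff e one_pos).2 h
    rw [hU] at h
    exact h
  exact he fun x => ⟨i x, key (hi _)⟩

/-- Every function in the limit ultrapower agrees almost everywhere with an evaluation. -/
theorem exists_eventually_eq_eval (e : Reals ↪ₑ[lang] K) {f : (K → Reals) → Reals}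
    (hf : eqSet f ∈ evalFilter K) :
    ∃ c : K, ∀ᶠ i in (typeUltrafilter e : Filter (K → Reals)), i c = f i := by
  obtain ⟨n, x, hx⟩ := exists_factorsThrough_of_eqSet_mem hf
  -- Here `g` is `f` read on the tuples `i ∘ x`, with filler `0` elsewhere; `c` is the value at `x`
  -- of its extension to `K`.
  obtain ⟨c, hc⟩ := exists_snoc_mem_rel_graph e (Function.extend (fun i => i ∘ x) f 0) x
  refine ⟨c, ((eventually_comp_mem_iff e n.succ_pos).2 hc).mono fun i hi => ?_⟩
  have h1 : (i ∘ (Fin.snoc x c : Fin (n + 1) → K)) ∘ Fin.castSucc = i ∘ x :=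
    funext fun k => congrArg i (Fin.snoc_castSucc (α := fun _ => K) c x k)
  have h2 : (i ∘ (Fin.snoc x c : Fin (n + 1) → K)) (Fin.last n) = i c :=
    congrArg i (Fin.snoc_last (α := fun _ => K) c x)
  rw [Set.mem_ofPred_eq, h1, h2, hx.extend_apply] at hi
  exact hi

/-- Sending `b` to the class of the evaluation at `b` is an isomorphism onto the limit
ultrapower. -/
noncomputable def equivLimitUltrapower (e : Reals ↪ₑ[lang] K) :
    K ≃[lang] limitUltrapower lang Reals (typeUltrafilter e) (evalFilter K) where
  toEquiv := Equiv.ofBijective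
    (fun b => ⟨((fun i : K → Reals => i b) :
      (typeUltrafilter e : Filter (K → Reals)).Product fun _ => Reals), _, eqSet_eval_mem b, rfl⟩)
    ⟨fun x y h => by
      have h := Quotient.exact (congrArg Subtype.val h)
      exact (mem_rel_eq e two_pos 0 1 ![x, y]).1 ((eventually_comp_mem_iff e two_pos).1 h),
    by
      rintro ⟨_, f, hf, rfl⟩
      obtain ⟨c, hc⟩ := exists_eventually_eq_eval e hf
      exact ⟨c, Subtype.ext (Quotient.sound hc)⟩⟩
  map_fun' := by
    intro n φ x
    refine Subtype.ext ?_
    refine Eq.trans ?_ (Language.Ultraproduct.funMap_cast (u := typeUltrafilter e) φ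
      (fun k (i : K → Reals) => i (x k))).symm
    refine Quotient.sound ?_
    -- The tuple `x` with its value appended lies on the graph of the operation, hence so do almost
    -- all its evaluations.
    have h := (eventually_comp_mem_iff e n.succ_pos).2 ((mem_rel_funMap e φ
      (Fin.snoc x (Language.Structure.funMap φ x))).2 (by
        rw [Fin.snoc_last]
        congr 1
        funext k
        simp))
    refine h.mono fun i hi => ?_
    have hi : i _ = Language.Structure.funMap φ _ := hi
    rw [Fin.snoc_last] at hi
    refine hi.trans (congrArg _ (funext fun k => ?_))
    exact congrArg i (Fin.snoc_castSucc (α := fun _ => K) _ x k)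
  map_rel' := by
    intro n r x
    refine (relMap_ultraproduct_cast (U := typeUltrafilter e) r
      (fun k (i : K → Reals) => i (x k))).trans ?_
    cases r with
    | le => exact (eventually_comp_mem_iff e two_pos).trans (mem_rel_le e two_pos 0 1 x)
    | pred hm R => exact eventually_comp_mem_iff e hm

end Transfer

/-! ### The one-step construction is the limit ultrapower -/

section OneStepEquiv

variable {I : Type u} (U : Ultrafilter I) (G : Filter (I × I))

theorem exists_cls_eq (f : I → Reals) : ∃ F : AFun I, F.cls = f := by
  choose g hg using fun i => QuotientAddGroup.mk_surjective (f i)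
  exact ⟨⟨fun p => (g p.2).1 p.1, fun i => (g i).2⟩, funext hg⟩

/-- The map `[F]_στ ↦ [i ↦ [F(·, i)]_σ]_τ`. -/
def OneStep.toLimitUltrapower (x : OneStep U G) : limitUltrapower lang Reals U G :=
  Quotient.lift (fun F : AFunOn G =>
    (⟨(F.1.cls : (U : Filter I).Product fun _ => Reals), F.1.cls, F.2, rfl⟩ :
      limitUltrapower lang Reals U G))
    (fun _ _ h => Subtype.ext (Quotient.sound (sigmaTauEquiv_iff.1 h))) x

theorem OneStep.toLimitUltrapower_mk (F : AFunOn G) :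
    (OneStep.toLimitUltrapower U G (OneStep.mk U F) : (U : Filter I).Product fun _ => Reals) =
      (F.1.cls : (U : Filter I).Product fun _ => Reals) := rfl

theorem OneStep.toLimitUltrapower_bijective :
    Function.Bijective (OneStep.toLimitUltrapower U G) := by
  refine ⟨?_, ?_⟩
  · rintro ⟨F⟩ ⟨F'⟩ h
    exact Quotient.sound (sigmaTauEquiv_iff.2 (Quotient.exact (congrArg Subtype.val h)))
  · rintro ⟨_, f, hf, rfl⟩
    obtain ⟨F, rfl⟩ := exists_cls_eq f
    exact ⟨OneStep.mk U ⟨F, hf⟩, rfl⟩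

/-- The isomorphism `[F]_στ ↦ [i ↦ [F(·, i)]_σ]_τ` onto the limit ultrapower. -/
noncomputable def OneStep.equivLimitUltrapower :
    OneStep U G ≃[lang] limitUltrapower lang Reals U G where
  toEquiv := Equiv.ofBijective _ (OneStep.toLimitUltrapower_bijective U G)
  map_fun' := by
    intro n φ x
    obtain ⟨F, rfl⟩ : ∃ F : Fin n → AFunOn G, (fun k => OneStep.mk U (F k)) = x :=
      ⟨fun k => (x k).out, funext fun k => Quotient.out_eq (x k)⟩
    refine Subtype.ext ?_
    refine Eq.trans ?_ (Language.Ultraproduct.funMap_cast (u := U) φ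
      (fun k => (F k).1.cls)).symm
    refine (congrArg (fun z => (OneStep.toLimitUltrapower U G z).1)
      (@Language.funMap_quotient_mk' lang _ (sigmaTauSetoid U G) (oneStepPrestructure U G)
        n φ F)).trans ?_
    cases φ <;> rfl
  map_rel' := by
    intro n r x
    obtain ⟨F, rfl⟩ : ∃ F : Fin n → AFunOn G, (fun k => OneStep.mk U (F k)) = x :=
      ⟨fun k => (x k).out, funext fun k => Quotient.out_eq (x k)⟩
    refine (relMap_ultraproduct_cast (U := U) r (fun k => (F k).1.cls)).trans ?_
    refine Iff.trans ?_ (@Language.relMap_quotient_mk' lang _ (sigmaTauSetoid U G)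
      (oneStepPrestructure U G) n r F).symm
    cases r <;> exact Iff.rfl

end OneStepEquiv

end Eudoxus

theorem theorem4 (K : Type u) [Field K] [LinearOrder K] [IsStrictOrderedRing K]
    [Eudoxus.RelInterp K] (hK : Eudoxus.IsHyperreal K) :
    ∃ (I : Type u) (U : Ultrafilter I) (G : Filter (I × I)),
      Infinite I ∧ (∀ i, U ≠ pure i) ∧ G.NeBot ∧
      Nonempty (K ≃[Eudoxus.lang] Eudoxus.OneStep U G) ∧
      ∃ Φ : Eudoxus.OneStep U G ≃[Eudoxus.lang]
          Eudoxus.limitUltrapower Eudoxus.lang Eudoxus.Reals U G,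
        ∀ F : Eudoxus.AFunOn G,
          (Φ (Eudoxus.OneStep.mk U F) : (U : Filter I).Product fun _ => Eudoxus.Reals) =
            (F.1.cls : (U : Filter I).Product fun _ => Eudoxus.Reals) := by
  obtain ⟨e, he⟩ := hK
  have hU := Eudoxus.typeUltrafilter_ne_pure e he
  refine ⟨K → Eudoxus.Reals, Eudoxus.typeUltrafilter e, Eudoxus.evalFilter K, ?_, hU,
    inferInstance, ⟨(Eudoxus.OneStep.equivLimitUltrapower _ _).symm.comp
      (Eudoxus.equivLimitUltrapower e)⟩, Eudoxus.OneStep.equivLimitUltrapower _ _,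
    Eudoxus.OneStep.toLimitUltrapower_mk _ _⟩
  -- On a finite index set every ultrafilter is principal.
  refine not_finite_iff_infinite.1 fun _ => ?_
  obtain ⟨i, hi⟩ := (Eudoxus.typeUltrafilter e).eq_pure_of_finite
  exact hU i hi
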